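/- Let $n\in\mathbb N_0$, let $\mu=(\mu_1,\dots,\mu_n)\in\mathbb R^n$ with $\mu_i\ge -\tfrac12$ for all $i$, and put $\Omega=(0,\infty)^n$, $\|x\|^2=x_1^2+\cdots+x_n^2$ and $x^{-\mu-1/2}=\prod_{i=1}^n x_i^{-\mu_i-1/2}$ for $x\in\Omega$. For $i=1,\dots,n$ let $$T_i=x_i^{-1}\frac{\partial}{\partial x_i},\qquad S_{\mu_i}=\frac{\partial^2}{\partial x_i^2}-\frac{4\mu_i^2-1}{4x_i^2},$$ and for a multi-index $k=(k_1,\dots,k_n)\in\mathbb N_0^n$ let $T^k=T_n^{k_n}\circ\cdots\circ T_1^{k_1}$ and $S^k=S_{\mu_n}^{k_n}\circ\cdots\circ S_{\mu_1}^{k_1}$. Let $\mathcal H_\mu$ be the space of all complex-valued $\phi\in C^\infty(\Omega)$ such that, for all $m\in\mathbb N_0$ and $k\in\mathbb N_0^n$, $$\gamma^\mu_{m,k}(\phi)=\sup_{x\in\Omega}\bigl|(1+\|x\|^2)^m\,T^k\{x^{-\mu-1/2}\phi(x)\}\bigr|<\infty .$$ Then for all $m\in\mathbb N_0$, $k\in\mathbb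 N_0^n$ and $\phi\in\mathcal H_\mu$ the quantity $$\lambda^\mu_{m,k}(\phi)=\sup_{x\in\Omega}\bigl|(1+\|x\|^2)^m\,x^{-\mu-1/2}\,S^k\phi(x)\bigr|$$ is finite, and the families of seminorms $\{\lambda^\mu_{m,k}\}_{m,k}$ and $\{\gamma^\mu_{m,k}\}_{m,k}$ generate the same locally convex topology on $\mathcal H_\mu$. -/

import Mathlib

open scoped ContDiff

noncomputable section

namespace Zemanian

/-- The open positive orthant `(0, ∞)ⁿ`. -/
def orthant (n : ℕ) : Set (Fin n → ℝ) := {x | ∀ i, 0 < x i}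

theorem isOpen_orthant (n : ℕ) : IsOpen (orthant n) := by
  have h : orthant n = ⋂ i, {x : Fin n → ℝ | 0 < x i} := by
    ext x; simp [orthant]
  rw [h]
  exact isOpen_iInter_of_finite fun i => isOpen_lt continuous_const (continuous_apply i)

/-- The extension by zero to `ℝⁿ` of a function on the orthant. It only serves to apply the
calculus of `ℝⁿ` at the points of the orthant, which is open. -/
def ext0 {n : ℕ} (f : orthant n → ℂ) : (Fin n → ℝ) → ℂ := Function.extend Subtype.val f 0

theorem ext0_coe {n : ℕ} (f : orthant n → ℂ) (x : orthant n) : ext0 f x = f x :=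
  Subtype.val_injective.extend_apply f 0 x

theorem contDiffOn_ext0 {n : ℕ} {f : orthant n → ℂ} {g : (Fin n → ℝ) → ℂ}
    (hg : ContDiffOn ℝ ∞ g (orthant n)) (h : ∀ x : orthant n, f x = g x) :
    ContDiffOn ℝ ∞ (ext0 f) (orthant n) :=
  hg.congr fun x hx => (ext0_coe f ⟨x, hx⟩).trans (h ⟨x, hx⟩)

/-- The algebra `C^∞((0, ∞)ⁿ)` of smooth complex-valued functions on the orthant. -/
def Smooth (n : ℕ) : Subalgebra ℂ (orthant n → ℂ) where
  carrier := {f | ContDiffOn ℝ ∞ (ext0 f) (orthant n)}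
  mul_mem' {f g} hf hg :=
    contDiffOn_ext0 (ContDiffOn.mul hf hg) fun x => by simp [ext0_coe]
  add_mem' {f g} hf hg :=
    contDiffOn_ext0 (ContDiffOn.add hf hg) fun x => by simp [ext0_coe]
  algebraMap_mem' c :=
    contDiffOn_ext0 (g := fun _ => c) contDiffOn_const fun x => by simp

theorem Smooth.differentiableAt {n : ℕ} (f : Smooth n) (x : orthant n) :
    DifferentiableAt ℝ (ext0 f.1) x :=
  ((show ContDiffOn ℝ ∞ (ext0 f.1) (orthant n) from f.2).differentiableOn
    (by simp)).differentiableAt ((isOpen_orthant n).mem_nhds x.2)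

theorem ext0_add {n : ℕ} (f g : orthant n → ℂ) : ext0 (f + g) = ext0 f + ext0 g := by
  ext x
  by_cases hx : x ∈ orthant n
  · simp only [Pi.add_apply]
    exact (ext0_coe (f + g) ⟨x, hx⟩).trans
      (congrArg₂ (· + ·) (ext0_coe f ⟨x, hx⟩).symm (ext0_coe g ⟨x, hx⟩).symm)
  · simp [ext0, Function.extend_apply', hx]

theorem ext0_smul {n : ℕ} (c : ℂ) (f : orthant n → ℂ) : ext0 (c • f) = c • ext0 f := by
  ext x
  by_cases hx : x ∈ orthant n
  · simp only [Pi.smul_apply]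
    exact (ext0_coe (c • f) ⟨x, hx⟩).trans
      (congrArg (c • ·) (ext0_coe f ⟨x, hx⟩).symm)
  · simp [ext0, Function.extend_apply', hx]

/-- The partial derivative `∂/∂xᵢ` on `C^∞((0, ∞)ⁿ)`. -/
def partialD {n : ℕ} (i : Fin n) : Module.End ℂ (Smooth n) where
  toFun f :=
    ⟨fun x => fderiv ℝ (ext0 f.1) x (Pi.single i 1),
      contDiffOn_ext0 (g := fun x => fderiv ℝ (ext0 f.1) x (Pi.single i 1))
        (((show ContDiffOn ℝ ∞ (ext0 f.1) (orthant n) from f.2).fderiv_of_isOpen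
          (isOpen_orthant n) (by simp)).clm_apply contDiffOn_const) fun _ => rfl⟩
  map_add' f g := by
    ext x
    change fderiv ℝ (ext0 (f.1 + g.1)) x (Pi.single i 1) = _
    rw [ext0_add, fderiv_add (Smooth.differentiableAt f x) (Smooth.differentiableAt g x)]
    rfl
  map_smul' c f := by
    ext x
    change fderiv ℝ (ext0 (c • f.1)) x (Pi.single i 1) = _
    rw [ext0_smul, fderiv_const_smul (Smooth.differentiableAt f x)]
    rfl

/-- The function `x ↦ xᵢ ^ a` (real exponent `a`) in `C^∞((0, ∞)ⁿ)`. -/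
def coordPow {n : ℕ} (i : Fin n) (a : ℝ) : Smooth n :=
  ⟨fun x => ((x.1 i ^ a : ℝ) : ℂ),
    contDiffOn_ext0 (g := fun x => ((x i ^ a : ℝ) : ℂ))
      (Complex.ofRealCLM.contDiff.comp_contDiffOn
        ((contDiff_apply ℝ ℝ i).contDiffOn.rpow_const_of_ne fun _ hx => (hx i).ne'))
      fun _ => rfl⟩

/-- The function `x ↦ x^{-μ-1/2} = ∏ᵢ xᵢ ^ (-μᵢ - 1/2)`. -/
def powMu {n : ℕ} (μ : Fin n → ℝ) : Smooth n := ∏ i, coordPow i (-μ i - 1 / 2)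

/-- The operator `Tᵢ = xᵢ⁻¹ ∂/∂xᵢ`. -/
def opT {n : ℕ} (i : Fin n) : Module.End ℂ (Smooth n) :=
  LinearMap.mulLeft ℂ (coordPow i (-1)) * partialD i

/-- The Bessel operator `S_{μᵢ} = ∂²/∂xᵢ² - (4 μᵢ² - 1) / (4 xᵢ²)`. -/
def opS {n : ℕ} (μ : Fin n → ℝ) (i : Fin n) : Module.End ℂ (Smooth n) :=
  partialD i * partialD i -
    (((4 * μ i ^ 2 - 1) / 4 : ℝ) : ℂ) • LinearMap.mulLeft ℂ (coordPow i (-2))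

/-- For operators `A₁, …, Aₙ` and a multi-index `k`, the operator
`A^k = Aₙ^{kₙ} ∘ ⋯ ∘ A₁^{k₁}`. -/
def multiPow {n : ℕ} (A : Fin n → Module.End ℂ (Smooth n)) (k : Fin n → ℕ) :
    Module.End ℂ (Smooth n) :=
  ((List.finRange n).map fun i => A i ^ k i).reverse.prod

/-- The function `x ↦ (1 + ‖x‖²)^m |f(x)|` on the orthant, `‖x‖` being the Euclidean norm. -/
def weighted {n : ℕ} (m : ℕ) (f : Smooth n) (x : orthant n) : ℝ :=
  (1 + ∑ i, x.1 i ^ 2) ^ m * ‖f.1 x‖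

theorem weighted_nonneg {n : ℕ} (m : ℕ) (f : Smooth n) (x : orthant n) :
    0 ≤ weighted m f x := by
  unfold weighted; positivity

theorem weighted_add_le {n : ℕ} (m : ℕ) (f g : Smooth n) (x : orthant n) :
    weighted m (f + g) x ≤ weighted m f x + weighted m g x := by
  unfold weighted
  rw [← mul_add]
  exact mul_le_mul_of_nonneg_left (norm_add_le (f.1 x) (g.1 x)) (by positivity)

theorem weighted_smul {n : ℕ} (m : ℕ) (c : ℂ) (f : Smooth n) (x : orthant n) :
    weighted m (c • f) x = ‖c‖ * weighted m f x := by
  change (1 + ∑ i, x.1 i ^ 2) ^ m * ‖c * f.1 x‖ = _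
  rw [norm_mul, weighted]
  ring

/-- `sup_x (1 + ‖x‖²)^m |f(x)| < ∞`. -/
def WeightedBdd {n : ℕ} (m : ℕ) (f : Smooth n) : Prop := BddAbove (Set.range (weighted m f))

theorem WeightedBdd.add {n : ℕ} {m : ℕ} {f g : Smooth n} (hf : WeightedBdd m f)
    (hg : WeightedBdd m g) : WeightedBdd m (f + g) := by
  obtain ⟨a, ha⟩ := hf
  obtain ⟨b, hb⟩ := hg
  refine ⟨a + b, ?_⟩
  rintro _ ⟨x, rfl⟩
  exact (weighted_add_le m f g x).trans (add_le_add (ha ⟨x, rfl⟩) (hb ⟨x, rfl⟩))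

theorem WeightedBdd.smul {n : ℕ} {m : ℕ} (c : ℂ) {f : Smooth n} (hf : WeightedBdd m f) :
    WeightedBdd m (c • f) := by
  obtain ⟨a, ha⟩ := hf
  refine ⟨‖c‖ * a, ?_⟩
  rintro _ ⟨x, rfl⟩
  rw [weighted_smul]
  exact mul_le_mul_of_nonneg_left (ha ⟨x, rfl⟩) (norm_nonneg c)

theorem weightedBdd_zero {n : ℕ} (m : ℕ) : WeightedBdd m (0 : Smooth n) := by
  refine ⟨0, ?_⟩
  rintro _ ⟨x, rfl⟩
  simp [weighted]

/-- For a linear map `L : V → C^∞((0, ∞)ⁿ)` such that all the suprema are finite, the seminorm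
`φ ↦ sup_x (1 + ‖x‖²)^m |(L φ)(x)|` on `V`. -/
def supSeminorm {n : ℕ} {V : Type*} [AddCommGroup V] [Module ℂ V] (m : ℕ)
    (L : V →ₗ[ℂ] Smooth n) (h : ∀ φ, WeightedBdd m (L φ)) : Seminorm ℂ V :=
  Seminorm.of (fun φ => ⨆ x : orthant n, weighted m (L φ) x)
    (fun φ ψ => by
      have : Nonempty (orthant n) := ⟨⟨fun _ => 1, fun _ => one_pos⟩⟩
      refine ciSup_le fun x => ?_
      rw [map_add]
      exact (weighted_add_le m _ _ x).trans
        (add_le_add (le_ciSup (h φ) x) (le_ciSup (h ψ) x)))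
    (fun c φ => by
      simp only [map_smul, weighted_smul]
      exact (Real.mul_iSup_of_nonneg (norm_nonneg c) _).symm)

/-- The linear map `φ ↦ T^k {x^{-μ-1/2} φ}`. -/
def gammaMap {n : ℕ} (μ : Fin n → ℝ) (k : Fin n → ℕ) : Module.End ℂ (Smooth n) :=
  multiPow opT k * LinearMap.mulLeft ℂ (powMu μ)

/-- The linear map `φ ↦ x^{-μ-1/2} S^k φ`. -/
def lambdaMap {n : ℕ} (μ : Fin n → ℝ) (k : Fin n → ℕ) : Module.End ℂ (Smooth n) :=
  LinearMap.mulLeft ℂ (powMu μ) * multiPow (opS μ) k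

/-- The Zemanian space `H_μ`: the smooth functions `φ` on the orthant such that
`sup_x (1 + ‖x‖²)^m |T^k {x^{-μ-1/2} φ(x)}| < ∞` for all `m` and `k`. -/
def HSpace {n : ℕ} (μ : Fin n → ℝ) : Submodule ℂ (Smooth n) where
  carrier := {φ | ∀ (m : ℕ) (k : Fin n → ℕ), WeightedBdd m (gammaMap μ k φ)}
  add_mem' {φ ψ} hφ hψ m k := by
    rw [map_add]
    exact (hφ m k).add (hψ m k)
  zero_mem' m k := by
    rw [map_zero]
    exact weightedBdd_zero m
  smul_mem' c φ hφ m k := by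
    rw [map_smul]
    exact (hφ m k).smul c

/-- The family `γ_{m,k}(φ) = sup_x (1 + ‖x‖²)^m |T^k {x^{-μ-1/2} φ(x)}|` of seminorms on
`H_μ`. -/
def gammaFamily {n : ℕ} (μ : Fin n → ℝ) :
    SeminormFamily ℂ (HSpace μ) (ℕ × (Fin n → ℕ)) :=
  fun p => supSeminorm p.1 (gammaMap μ p.2 ∘ₗ (HSpace μ).subtype) fun φ => φ.2 p.1 p.2

/-- All the suprema `sup_x (1 + ‖x‖²)^m |x^{-μ-1/2} S^k φ(x)|`, `φ ∈ H_μ`, are finite. -/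
def LambdaFinite {n : ℕ} (μ : Fin n → ℝ) : Prop :=
  ∀ (m : ℕ) (k : Fin n → ℕ) (φ : HSpace μ), WeightedBdd m (lambdaMap μ k φ)

/-- The family `λ_{m,k}(φ) = sup_x (1 + ‖x‖²)^m |x^{-μ-1/2} S^k φ(x)|` of seminorms on
`H_μ`. -/
def lambdaFamily {n : ℕ} (μ : Fin n → ℝ) (h : LambdaFinite μ) :
    SeminormFamily ℂ (HSpace μ) (ℕ × (Fin n → ℕ)) :=
  fun p => supSeminorm p.1 (lambdaMap μ p.2 ∘ₗ (HSpace μ).subtype) fun φ => h p.1 p.2 φ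

/-- The locally convex topology generated by a family of seminorms. -/
@[reducible]
def seminormTopology {V ι : Type*} [AddCommGroup V] [Module ℂ V] [Nonempty ι]
    (p : SeminormFamily ℂ V ι) : TopologicalSpace V :=
  p.moduleFilterBasis.topology

end Zemanian

end

noncomputable section

namespace Zemanian

/-! ### The algebra of the differential operators -/

/-! Put `f = x^{-μ-1/2} φ`. Conjugation by `x^{-μ-1/2}` turns `S_{μᵢ}` into `Bᵢ = (xᵢ² Tᵢ + 2μᵢ + 2)
Tᵢ` (`semiconjBy_powMu`), so both families are weighted sup norms of `f`: one of `T^k f`, the other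
of `B^k f` (`lambdaMap_eq`).

That `T` controls `B` is algebra: `Bᵢ` is built from `Tᵢ` and multiplication by `xᵢ²`, the relation
`Tᵢ xᵢ² = xᵢ² Tᵢ + 2` moves every `Tᵢ` to the right, and each factor `xᵢ²` costs one unit of `m`
(`isBoundedOp_mulLeft_coordPow_two`). This also gives finiteness.

For the converse, let `D_c = xᵢ² Tᵢ + c = xᵢ ∂/∂xᵢ + c`. Then `Tᵢ^j Bᵢ = D_c Tᵢ^{j+1}` with `c = 2μᵢ
+ 2 + 2j > 0` (`opT_pow_mul_opB`), so inverting `D_c` boundedly trades one `Tᵢ` for one `Bᵢ`. In the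
variable `t = log xᵢ`, `D_c` is `d/dt + c`, and a bounded solution of `u' + cu = v` satisfies `sup
|u| ≤ sup |v| / |c|` (`norm_le_of_hasDerivAt`). The weighted form is
`weighted_le_of_weighted_opD_le`; induction on the order and on the coordinates finishes. -/

theorem partialD_apply {n : ℕ} (i : Fin n) (f : Smooth n) (x : orthant n) :
    (partialD i f).1 x = fderiv ℝ (ext0 f.1) x (Pi.single i 1) := rfl

theorem coordPow_apply {n : ℕ} (i : Fin n) (a : ℝ) (x : orthant n) :
    (coordPow i a).1 x = ((x.1 i ^ a : ℝ) : ℂ) := rfl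

theorem eventuallyEq_ext0 {n : ℕ} {f : orthant n → ℂ} {g : (Fin n → ℝ) → ℂ}
    (h : ∀ x : orthant n, f x = g x) (x : orthant n) : ext0 f =ᶠ[nhds x.1] g := by
  filter_upwards [(isOpen_orthant n).mem_nhds x.2] with y hy
  exact (ext0_coe f ⟨y, hy⟩).trans (h ⟨y, hy⟩)

theorem partialD_apply_of_hasFDerivAt {n : ℕ} (i : Fin n) (f : Smooth n)
    {g : (Fin n → ℝ) → ℂ} (h : ∀ x : orthant n, f.1 x = g x) (x : orthant n)
    {g' : (Fin n → ℝ) →L[ℝ] ℂ} (hg : HasFDerivAt g g' x) :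
    (partialD i f).1 x = g' (Pi.single i 1) := by
  rw [partialD_apply, (eventuallyEq_ext0 h x).fderiv_eq, hg.fderiv]

theorem partialD_mul {n : ℕ} (i : Fin n) (f g : Smooth n) :
    partialD i (f * g) = partialD i f * g + f * partialD i g := by
  ext x
  have h := partialD_apply_of_hasFDerivAt i (f * g) (g := ext0 f.1 * ext0 g.1)
    (fun y => by simp [ext0_coe]) x
    ((Smooth.differentiableAt f x).hasFDerivAt.mul (Smooth.differentiableAt g x).hasFDerivAt)
  refine h.trans ?_
  simp [ext0_coe, partialD_apply]
  ring

/-- Symmetry of the second derivative on the open orthant. -/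
theorem partialD_comm {n : ℕ} (i j : Fin n) : Commute (partialD (n := n) i) (partialD j) := by
  have key : ∀ (i j : Fin n) (f : Smooth n) (x : orthant n), (partialD i (partialD j f)).1 x =
      fderiv ℝ (fderiv ℝ (ext0 f.1)) x (Pi.single i 1) (Pi.single j 1) := by
    intro i j f x
    have hf : ContDiffOn ℝ ∞ (fderiv ℝ (ext0 f.1)) (orthant n) :=
      (show ContDiffOn ℝ ∞ (ext0 f.1) (orthant n) from f.2).fderiv_of_isOpen
          (isOpen_orthant n) (by simp)
    have hd : DifferentiableAt ℝ (fderiv ℝ (ext0 f.1)) x :=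
      (hf.differentiableOn (by simp)).differentiableAt ((isOpen_orthant n).mem_nhds x.2)
    have h := partialD_apply_of_hasFDerivAt i (partialD j f)
      (g := fun x => fderiv ℝ (ext0 f.1) x (Pi.single j 1)) (fun y => rfl) x
      (hd.hasFDerivAt.clm_apply (hasFDerivAt_const _ _))
    rw [h]
    simp
  refine LinearMap.ext fun f => ?_
  ext x
  change (partialD i (partialD j f)).1 x = (partialD j (partialD i f)).1 x
  rw [key, key]
  refine ContDiffAt.isSymmSndFDerivAt (n := ∞) ?_ 
    (by simpa using WithTop.coe_le_coe.2 (le_top : (2 : ℕ∞) ≤ ⊤)) _ _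
  exact (show ContDiffOn ℝ ∞ (ext0 f.1) (orthant n) from f.2).contDiffAt
    ((isOpen_orthant n).mem_nhds x.2)

theorem hasFDerivAt_coordPow {n : ℕ} (i : Fin n) (a : ℝ) (x : orthant n) :
    HasFDerivAt (fun y : Fin n → ℝ => ((y i ^ a : ℝ) : ℂ))
      (Complex.ofRealCLM.comp
        ((a * x.1 i ^ (a - 1)) • (ContinuousLinearMap.proj i : (Fin n → ℝ) →L[ℝ] ℝ))) x.1 := by
  refine Complex.ofRealCLM.hasFDerivAt.comp x.1 ?_
  exact (Real.hasDerivAt_rpow_const (Or.inl (x.2 i).ne')).comp_hasFDerivAt x.1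
    (hasFDerivAt_apply (𝕜 := ℝ) i x.1)

theorem partialD_coordPow_self {n : ℕ} (i : Fin n) (a : ℝ) :
    partialD i (coordPow i a) = (a : ℂ) • coordPow i (a - 1) := by
  ext x
  rw [partialD_apply_of_hasFDerivAt i _ (fun y => rfl) x (hasFDerivAt_coordPow i a x)]
  simp [coordPow_apply]

theorem partialD_coordPow_of_ne {n : ℕ} {i j : Fin n} (h : i ≠ j) (a : ℝ) :
    partialD i (coordPow j a) = 0 := by
  ext x
  rw [partialD_apply_of_hasFDerivAt i _ (fun y => rfl) x (hasFDerivAt_coordPow j a x)]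
  simp [h.symm]

theorem coordPow_mul {n : ℕ} (i : Fin n) (a b : ℝ) :
    coordPow i a * coordPow i b = coordPow i (a + b) := by
  ext x
  simp [coordPow_apply, Real.rpow_add (x.2 i)]

theorem coordPow_zero {n : ℕ} (i : Fin n) : coordPow i 0 = 1 := by
  ext x
  simp [coordPow_apply]

theorem opT_apply {n : ℕ} (i : Fin n) (f : Smooth n) :
    opT i f = coordPow i (-1) * partialD i f := rfl

theorem opT_mul {n : ℕ} (i : Fin n) (f g : Smooth n) :
    opT i (f * g) = opT i f * g + f * opT i g := by
  simp only [opT_apply, partialD_mul]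
  ring

theorem opT_coordPow_two {n : ℕ} (i : Fin n) : opT i (coordPow i 2) = (2 : ℂ) • 1 := by
  rw [opT_apply, partialD_coordPow_self, mul_smul_comm, coordPow_mul]
  norm_num [coordPow_zero]

theorem opT_coordPow_of_ne {n : ℕ} {i j : Fin n} (h : i ≠ j) (a : ℝ) :
    opT i (coordPow j a) = 0 := by
  rw [opT_apply, partialD_coordPow_of_ne h, mul_zero]

/-- `Tᵢ` is a derivation with `Tᵢ(xᵢ²) = 2`, being twice the derivative in `xᵢ²`. -/
theorem opT_mulLeft_coordPow_two {n : ℕ} (i : Fin n) :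
    opT i * LinearMap.mulLeft ℂ (coordPow i 2) =
      LinearMap.mulLeft ℂ (coordPow i 2) * opT i + (2 : ℂ) • 1 := by
  refine LinearMap.ext fun f => ?_
  change opT i (coordPow i 2 * f) = coordPow i 2 * opT i f + (2 : ℂ) • f
  rw [opT_mul, opT_coordPow_two, smul_mul_assoc, one_mul, add_comm]

theorem commute_opT_mulLeft_coordPow {n : ℕ} {i j : Fin n} (h : i ≠ j) (a : ℝ) :
    Commute (opT i) (LinearMap.mulLeft ℂ (coordPow j a)) := by
  refine LinearMap.ext fun f => ?_
  change opT i (coordPow j a * f) = coordPow j a * opT i f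
  rw [opT_mul, opT_coordPow_of_ne h, zero_mul, zero_add]

theorem commute_mulLeft {n : ℕ} (f g : Smooth n) :
    Commute (LinearMap.mulLeft ℂ f) (LinearMap.mulLeft ℂ g) := by
  refine LinearMap.ext fun h => ?_
  change f * (g * h) = g * (f * h)
  ring

theorem commute_partialD_mulLeft_coordPow {n : ℕ} {i j : Fin n} (h : i ≠ j) (a : ℝ) :
    Commute (partialD i) (LinearMap.mulLeft ℂ (coordPow j a)) := by
  refine LinearMap.ext fun f => ?_
  change partialD i (coordPow j a * f) = coordPow j a * partialD i f
  rw [partialD_mul, partialD_coordPow_of_ne h, zero_mul, zero_add]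

theorem commute_opT {n : ℕ} (i j : Fin n) : Commute (opT i) (opT j) := by
  rcases eq_or_ne i j with rfl | h
  · exact Commute.refl _
  · exact ((commute_opT_mulLeft_coordPow h _).mul_right
      ((((commute_partialD_mulLeft_coordPow h.symm (-1)).symm).mul_left (partialD_comm i j))))

/-- The first-order operator `xᵢ² Tᵢ + c = xᵢ ∂/∂xᵢ + c`. -/
def opD {n : ℕ} (c : ℝ) (i : Fin n) : Module.End ℂ (Smooth n) :=
  LinearMap.mulLeft ℂ (coordPow i 2) * opT i + (c : ℂ) • 1

/-- The operator `(xᵢ² Tᵢ + 2 μᵢ + 2) Tᵢ`, the conjugate of `S_{μᵢ}` by `x^{-μ-1/2}`. -/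
def opB {n : ℕ} (μ : Fin n → ℝ) (i : Fin n) : Module.End ℂ (Smooth n) :=
  opD (2 * μ i + 2) i * opT i

theorem opD_apply_coe {n : ℕ} (c : ℝ) (i : Fin n) (f : Smooth n) (x : orthant n) :
    (opD c i f).1 x = x.1 i * (partialD i f).1 x + c * f.1 x := by
  have h : opD c i f = coordPow i 1 * partialD i f + (c : ℂ) • f := by
    change coordPow i 2 * (coordPow i (-1) * partialD i f) + (c : ℂ) • f = _
    rw [← mul_assoc, coordPow_mul]
    norm_num
  rw [h]
  simp [coordPow_apply]

theorem opT_mul_opD {n : ℕ} (c : ℝ) (i : Fin n) :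
    opT i * opD c i = opD (c + 2) i * opT i := by
  simp only [opD]
  rw [mul_add, ← mul_assoc, opT_mulLeft_coordPow_two]
  simp only [add_mul, mul_smul_comm, smul_mul_assoc, mul_one, one_mul, Complex.ofReal_add,
    add_smul, Complex.ofReal_ofNat]
  abel

/-- Each passage of `Tᵢ` across `xᵢ² Tᵢ` produces an extra `2 Tᵢ`, which raises the constant by 2.
-/
theorem opT_pow_mul_opD {n : ℕ} (c : ℝ) (i : Fin n) (j : ℕ) :
    opT i ^ j * opD c i = opD (c + 2 * j) i * opT i ^ j := by
  induction j with
  | zero => simp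
  | succ j ih =>
    rw [pow_succ', mul_assoc, ih, ← mul_assoc, opT_mul_opD, mul_assoc]
    congr 2
    push_cast
    ring

theorem opT_pow_mul_opB {n : ℕ} (μ : Fin n → ℝ) (i : Fin n) (j : ℕ) :
    opT i ^ j * opB μ i = opD (2 * μ i + 2 + 2 * j) i * opT i ^ (j + 1) := by
  rw [opB, ← mul_assoc, opT_pow_mul_opD, mul_assoc, pow_succ]

theorem commute_opT_opB {n : ℕ} (μ : Fin n → ℝ) {i j : Fin n} (h : i ≠ j) :
    Commute (opT i) (opB μ j) := by
  refine Commute.mul_right (Commute.add_right ?_ ?_) (commute_opT i j)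
  · exact (commute_opT_mulLeft_coordPow h 2).mul_right (commute_opT i j)
  · exact (Commute.one_right _).smul_right _

theorem commute_opB {n : ℕ} (μ : Fin n → ℝ) {i j : Fin n} (h : i ≠ j) :
    Commute (opB μ i) (opB μ j) := by
  refine Commute.mul_left (Commute.add_left (Commute.mul_left ?_ (commute_opT_opB μ h))
    ((Commute.one_left _).smul_left _)) (commute_opT_opB μ h)
  have hm := (commute_opT_mulLeft_coordPow h.symm 2).symm
  exact ((((commute_mulLeft _ _).mul_right hm)).add_right
    ((Commute.one_right _).smul_right _)).mul_right hm

/-! ### Conjugation of the Bessel operators by `x^{-μ-1/2}` -/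

theorem partialD_prod_coordPow {n : ℕ} (i : Fin n) (a : Fin n → ℝ) (s : Finset (Fin n))
    (hi : i ∉ s) : partialD i (∏ j ∈ s, coordPow j (a j)) = 0 := by
  induction s using Finset.induction_on with
  | empty =>
    rw [Finset.prod_empty, ← coordPow_zero i, partialD_coordPow_self]
    simp
  | insert j s hj ih =>
    rw [Finset.mem_insert, not_or] at hi
    rw [Finset.prod_insert hj, partialD_mul, ih hi.2, partialD_coordPow_of_ne hi.1]
    simp

theorem partialD_powMu {n : ℕ} (μ : Fin n → ℝ) (i : Fin n) :
    partialD i (powMu μ) = ((-μ i - 1 / 2 : ℝ) : ℂ) • (coordPow i (-1) * powMu μ) := by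
  rw [powMu, ← Finset.mul_prod_erase _ _ (Finset.mem_univ i), partialD_mul,
    partialD_prod_coordPow i _ _ (Finset.notMem_erase i _), partialD_coordPow_self, ← mul_assoc,
    coordPow_mul, mul_zero, add_zero, smul_mul_assoc]
  congr 3
  ring_nf

/-- On `g = x^{-μ-1/2} f`, `Bᵢ` acts as `∂ᵢ² + (2μᵢ + 1) xᵢ⁻¹ ∂ᵢ`. The exponent `-μᵢ - 1/2` cancels
the first-order terms in `f` and leaves the potential `1/4 - μᵢ²` over `xᵢ²`. -/
theorem semiconjBy_powMu {n : ℕ} (μ : Fin n → ℝ) (i : Fin n) :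
    SemiconjBy (LinearMap.mulLeft ℂ (powMu μ)) (opS μ i) (opB μ i) := by
  refine LinearMap.ext fun f => ?_
  have hX : coordPow i (-2) = coordPow i (-1) * coordPow i (-1) := by
    rw [coordPow_mul]; norm_num
  have hXX : coordPow i 2 * (coordPow i (-1) * coordPow i (-1)) = 1 := by
    rw [coordPow_mul, coordPow_mul, ← coordPow_zero i]; norm_num
  have hD : partialD i (coordPow i (-1)) = -(coordPow i (-1) * coordPow i (-1)) := by
    rw [partialD_coordPow_self, ← hX]; norm_num
  change powMu μ * (partialD i (partialD i f) -
      (((4 * μ i ^ 2 - 1) / 4 : ℝ) : ℂ) • (coordPow i (-2) * f)) =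
    coordPow i 2 * opT i (opT i (powMu μ * f)) +
      ((2 * μ i + 2 : ℝ) : ℂ) • opT i (powMu μ * f)
  have hP := partialD_powMu μ i
  have h2 : ∀ g, coordPow i 2 * opT i (opT i g) =
      partialD i (partialD i g) - coordPow i (-1) * partialD i g := by
    intro g
    simp only [opT_apply, partialD_mul, hD]
    linear_combination (partialD i (partialD i g) - coordPow i (-1) * partialD i g) * hXX
  rw [h2, opT_apply, hX, partialD_mul, map_add, partialD_mul, hP, map_smul, smul_mul_assoc,
    partialD_mul, hD, partialD_mul, hP]
  ext x
  simp
  ring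

/-! ### A bound for bounded solutions of a first-order equation -/

/-- With the integrating factor `e^{ct}`, `(e^{ct} u)' = e^{ct} v`. The a priori bound `K` only
serves to exclude the homogeneous solution `e^{-ct}` and disappears from the estimate. -/
theorem norm_le_of_hasDerivAt_of_pos {u v : ℝ → ℂ} {c V K : ℝ} (hc : 0 < c)
    (hu : ∀ t, HasDerivAt u (v t - c * u t) t) (hv : ∀ t, ‖v t‖ ≤ V) (hK : ∀ t, ‖u t‖ ≤ K)
    (t : ℝ) : ‖u t‖ ≤ V / c := by
  have he : ∀ τ : ℝ, HasDerivAt (fun τ => Real.exp (c * τ)) (Real.exp (c * τ) * c) τ := fun τ => by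
    simpa using ((hasDerivAt_id τ).const_mul c).exp
  have hg : ∀ τ, HasDerivAt (fun τ => (Real.exp (c * τ) : ℂ) * u τ) (Real.exp (c * τ) * v τ) τ := by
    intro τ
    refine ((he τ).ofReal_comp.mul (hu τ)).congr_deriv ?_
    push_cast
    ring
  -- Comparison on `[s, t]` with a majorant of derivative `V e^{cτ}`; the term `K e^{cs}` absorbs
  -- the initial value.
  have hst : ∀ s ≤ t, Real.exp (c * t) * ‖u t‖ ≤
      V / c * Real.exp (c * t) + K * Real.exp (c * s) := by
    intro s hs
    have hV : 0 ≤ V := (norm_nonneg _).trans (hv 0)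
    have h := image_norm_le_of_norm_deriv_right_le_deriv_boundary (a := s) (b := t)
      (f := fun τ => (Real.exp (c * τ) : ℂ) * u τ) (f' := fun τ => Real.exp (c * τ) * v τ)
      (B := fun τ => V / c * Real.exp (c * τ) + K * Real.exp (c * s))
      (B' := fun τ => V / c * (Real.exp (c * τ) * c))
      (fun τ _ => (hg τ).continuousAt.continuousWithinAt)
      (fun τ _ => (hg τ).hasDerivWithinAt) ?_ (fun τ => ((he τ).const_mul _).add_const _) ?_
      (Set.right_mem_Icc.2 hs)
    · simpa [abs_of_pos (Real.exp_pos _), ← Complex.ofReal_exp] using h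
    · have h1 : 0 ≤ V / c * Real.exp (c * s) := by positivity
      rw [norm_mul, Complex.norm_real, Real.norm_of_nonneg (Real.exp_pos _).le]
      nlinarith [hK s, Real.exp_pos (c * s)]
    · intro τ _
      have h1 : V / c * (Real.exp (c * τ) * c) = Real.exp (c * τ) * V := by
        field_simp
      rw [h1, norm_mul, Complex.norm_real, Real.norm_of_nonneg (Real.exp_pos _).le]
      exact mul_le_mul_of_nonneg_left (hv τ) (Real.exp_pos _).le
  -- Letting the initial time `s` tend to `-∞` removes the contribution of `K`.
  have hlim : Filter.Tendsto (fun s => V / c * Real.exp (c * t) + K * Real.exp (c * s))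
      Filter.atBot (nhds (V / c * Real.exp (c * t) + K * 0)) :=
    ((Real.tendsto_exp_atBot.comp (Filter.tendsto_id.const_mul_atBot hc)).const_mul K).const_add _
  have h := ge_of_tendsto hlim ((Filter.eventually_le_atBot t).mono hst)
  rw [mul_zero, add_zero, mul_comm (V / c)] at h
  exact le_of_mul_le_mul_left h (Real.exp_pos _)

/-- A bounded solution `u` on the line of `u' + c u = v`, `c ≠ 0`, satisfies
`sup ‖u‖ ≤ sup ‖v‖ / |c|`. -/
theorem norm_le_of_hasDerivAt {u v : ℝ → ℂ} {c V K : ℝ} (hc : c ≠ 0)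
    (hu : ∀ t, HasDerivAt u (v t - c * u t) t) (hv : ∀ t, ‖v t‖ ≤ V) (hK : ∀ t, ‖u t‖ ≤ K)
    (t : ℝ) : ‖u t‖ ≤ V / |c| := by
  rcases hc.lt_or_gt with h | h
  -- For `c < 0`, time reversal changes the sign of `c`.
  · have h' : ∀ s, HasDerivAt (fun s => u (-s)) (-v (-s) - (-c : ℝ) * u (-s)) s := by
      intro s
      refine ((hu (-s)).scomp s (hasDerivAt_neg s)).congr_deriv ?_
      simp
      ring
    have := norm_le_of_hasDerivAt_of_pos (neg_pos.2 h) h' (V := V) (fun s => by simpa using hv _)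
      (fun s => hK _) (-t)
    simpa [abs_of_neg h] using this
  · rw [abs_of_pos h]
    exact norm_le_of_hasDerivAt_of_pos h hu hv hK t

/-! ### The estimate for `xᵢ ∂/∂xᵢ + c` -/

/-- The point of the orthant obtained from `x` by replacing its `i`-th coordinate by `e^t`. -/
def expUpdate {n : ℕ} (x : orthant n) (i : Fin n) (t : ℝ) : orthant n :=
  ⟨Function.update x.1 i (Real.exp t), fun j => by
    rcases eq_or_ne j i with rfl | h
    · simpa using Real.exp_pos t
    · simpa [h] using x.2 j⟩

theorem expUpdate_log {n : ℕ} (x : orthant n) (i : Fin n) :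
    expUpdate x i (Real.log (x.1 i)) = x := by
  ext j
  simp [expUpdate, Real.exp_log (x.2 i)]

/-- Under `xᵢ = e^t`, `xᵢ ∂/∂xᵢ` becomes `d/dt`. -/
theorem hasDerivAt_expUpdate {n : ℕ} (f : Smooth n) (x : orthant n) (i : Fin n) (c t : ℝ) :
    HasDerivAt (fun t => f.1 (expUpdate x i t))
      ((opD c i f).1 (expUpdate x i t) - c * f.1 (expUpdate x i t)) t := by
  have h := (Smooth.differentiableAt f (expUpdate x i t)).hasFDerivAt.comp_hasDerivAt t
    ((hasDerivAt_update x.1 i (Real.exp t)).scomp t (Real.hasDerivAt_exp t))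
  have hfun : (fun t => f.1 (expUpdate x i t)) = ext0 f.1 ∘ Function.update x.1 i ∘ Real.exp :=
    funext fun s => (ext0_coe f.1 (expUpdate x i s)).symm
  rw [hfun]
  refine h.congr_deriv ?_
  rw [opD_apply_coe, map_smul, partialD_apply]
  simp [expUpdate]

theorem weighted_expUpdate {n : ℕ} (m : ℕ) (f : Smooth n) (x : orthant n) (i : Fin n) (t : ℝ) :
    weighted m f (expUpdate x i t) =
      ((1 + ∑ j ∈ Finset.univ \ {i}, x.1 j ^ 2) + Real.exp t ^ 2) ^ m *
        ‖f.1 (expUpdate x i t)‖ := by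
  rw [weighted]
  congr 2
  rw [add_assoc, add_comm (∑ j ∈ _, _)]
  congr 1
  rw [Finset.sum_eq_add_sum_sdiff_singleton_of_mem (Finset.mem_univ i)]
  congr 1
  · simp [expUpdate]
  · refine Finset.sum_congr rfl fun j hj => ?_
    have : j ≠ i := by simpa using hj
    simp [expUpdate, this]

theorem add_pow_le_two_pow_mul {r s : ℝ} (hr : 1 ≤ r) (hs : 0 ≤ s) {m M : ℕ} (h : m ≤ M) :
    (r + s) ^ m ≤ 2 ^ m * (2 * r ^ m + s ^ M) := by
  have h1 : s ^ m ≤ r ^ m + s ^ M := by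
    rcases le_total s 1 with h1 | h1
    · exact (pow_le_one₀ hs h1).trans
        ((one_le_pow₀ hr).trans (le_add_of_nonneg_right (by positivity)))
    · exact (pow_le_pow_right₀ h1 h).trans (le_add_of_nonneg_left (by positivity))
  -- The subtraction is truncated, so `m = 0` is included.
  have h2 : (2 : ℝ) ^ (m - 1) ≤ 2 ^ m := pow_le_pow_right₀ one_le_two (Nat.sub_le _ _)
  calc (r + s) ^ m ≤ 2 ^ (m - 1) * (r ^ m + s ^ m) := add_pow_le (by linarith) hs m
    _ ≤ 2 ^ m * (2 * r ^ m + s ^ M) := by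
      refine mul_le_mul h2 (by linarith) (by positivity) (by positivity)

/-- The weight is split into `r^m`, with `r` independent of `xᵢ`, and `xᵢ^{2M}`. Multiplication by
`r^m` keeps the equation with constant `c`; multiplication by `xᵢ^{2M}` changes the constant to `c -
2M`. Raising `m` to `M` with `2M > c` keeps this constant away from 0, which `c - 2m` need not be.
The bounds on `f` itself are used only qualitatively. -/
theorem weighted_le_of_weighted_opD_le {n : ℕ} (i : Fin n) {c : ℝ} (hc : 0 < c) {m M : ℕ}
    (hm : m ≤ M) (hM : c < 2 * M) {f : Smooth n} (hf : ∀ N, WeightedBdd N f) {V : ℝ}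
    (hV : ∀ x, weighted M (opD c i f) x ≤ V) (x : orthant n) :
    weighted m f x ≤ 2 ^ m * (2 / c + 1 / (2 * M - c)) * V := by
  set r : ℝ := 1 + ∑ j ∈ Finset.univ \ {i}, x.1 j ^ 2 with hr
  have hr1 : 1 ≤ r := le_add_of_nonneg_right (Finset.sum_nonneg fun j _ => sq_nonneg _)
  have hr0 : 0 ≤ r := zero_le_one.trans hr1
  have hexp : ∀ t : ℝ, 0 ≤ Real.exp t ^ 2 := fun t => sq_nonneg _
  obtain ⟨K₁, hK₁⟩ := hf m
  obtain ⟨K₂, hK₂⟩ := hf M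
  have b1 : ∀ t, r ^ m * ‖f.1 (expUpdate x i t)‖ ≤ V / |c| := by
    intro t
    have h := norm_le_of_hasDerivAt (u := fun t => ((r ^ m : ℝ) : ℂ) * f.1 (expUpdate x i t))
      (v := fun t => ((r ^ m : ℝ) : ℂ) * (opD c i f).1 (expUpdate x i t)) (c := c) (V := V)
      (K := K₁) hc.ne' ?_ ?_ ?_ t
    · simpa [abs_of_nonneg hr0] using h
    · intro s
      refine ((hasDerivAt_expUpdate f x i c s).const_mul ((r ^ m : ℝ) : ℂ)).congr_deriv ?_
      ring
    · intro s
      refine le_trans ?_ (hV (expUpdate x i s))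
      rw [weighted_expUpdate, ← hr, norm_mul, Complex.norm_real,
        Real.norm_of_nonneg (by positivity)]
      refine mul_le_mul_of_nonneg_right ?_ (norm_nonneg _)
      exact (pow_le_pow_right₀ hr1 hm).trans (pow_le_pow_left₀ hr0 (by linarith [hexp s]) _)
    · intro s
      refine le_trans ?_ (hK₁ ⟨expUpdate x i s, rfl⟩)
      rw [weighted_expUpdate, ← hr, norm_mul, Complex.norm_real,
        Real.norm_of_nonneg (by positivity)]
      refine mul_le_mul_of_nonneg_right ?_ (norm_nonneg _)
      exact pow_le_pow_left₀ hr0 (by linarith [hexp s]) _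
  have b2 : ∀ t, (Real.exp t ^ 2) ^ M * ‖f.1 (expUpdate x i t)‖ ≤ V / |c - 2 * M| := by
    intro t
    have he : ∀ s : ℝ, HasDerivAt (fun s => (Real.exp s ^ 2) ^ M)
        (2 * M * (Real.exp s ^ 2) ^ M) s := by
      intro s
      have h : HasDerivAt (fun s : ℝ => Real.exp s ^ (2 * M))
        (2 * M * Real.exp s ^ (2 * M)) s := by
        have h := ((hasDerivAt_id s).const_mul ((2 * M : ℕ) : ℝ)).exp
        simp only [id, Real.exp_nat_mul] at h
        convert h using 1
        push_cast
        ring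
      simpa only [pow_mul] using h
    have h := norm_le_of_hasDerivAt
      (u := fun t => (((Real.exp t ^ 2) ^ M : ℝ) : ℂ) * f.1 (expUpdate x i t))
      (v := fun t => (((Real.exp t ^ 2) ^ M : ℝ) : ℂ) * (opD c i f).1 (expUpdate x i t))
      (c := c - 2 * M) (V := V) (K := K₂) (by linarith) ?_ ?_ ?_ t
    · rw [norm_mul, Complex.norm_real, Real.norm_of_nonneg (by positivity)] at h
      exact h
    · intro s
      refine ((he s).ofReal_comp.mul (hasDerivAt_expUpdate f x i c s)).congr_deriv ?_
      push_cast
      ring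
    · intro s
      refine le_trans ?_ (hV (expUpdate x i s))
      rw [weighted_expUpdate, ← hr, norm_mul, Complex.norm_real,
        Real.norm_of_nonneg (by positivity)]
      refine mul_le_mul_of_nonneg_right ?_ (norm_nonneg _)
      exact pow_le_pow_left₀ (hexp s) (by linarith) _
    · intro s
      refine le_trans ?_ (hK₂ ⟨expUpdate x i s, rfl⟩)
      rw [weighted_expUpdate, ← hr, norm_mul, Complex.norm_real,
        Real.norm_of_nonneg (by positivity)]
      refine mul_le_mul_of_nonneg_right ?_ (norm_nonneg _)
      exact pow_le_pow_left₀ (hexp s) (by linarith) _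
  -- The point `x` lies on its own curve, at `t = log xᵢ`.
  rw [← expUpdate_log x i, weighted_expUpdate, ← hr]
  generalize Real.log (x.1 i) = t
  have h1 := b1 t
  have h2 := b2 t
  rw [abs_of_pos hc] at h1
  rw [abs_sub_comm, abs_of_pos (by linarith)] at h2
  calc (r + Real.exp t ^ 2) ^ m * ‖f.1 (expUpdate x i t)‖
      ≤ 2 ^ m * (2 * r ^ m + (Real.exp t ^ 2) ^ M) * ‖f.1 (expUpdate x i t)‖ :=
        mul_le_mul_of_nonneg_right (add_pow_le_two_pow_mul hr1 (hexp t) hm) (norm_nonneg _)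
    _ = 2 ^ m * (2 * (r ^ m * ‖f.1 (expUpdate x i t)‖) +
          (Real.exp t ^ 2) ^ M * ‖f.1 (expUpdate x i t)‖) := by ring
    _ ≤ 2 ^ m * (2 * (V / c) + V / (2 * M - c)) :=
        mul_le_mul_of_nonneg_left (by linarith) (by positivity)
    _ = 2 ^ m * (2 / c + 1 / (2 * M - c)) * V := by ring

/-! ### Powers of commuting operators -/

theorem multiPow_zero {n : ℕ} (A : Fin n → Module.End ℂ (Smooth n)) : multiPow A 0 = 1 := by
  simp [multiPow]

theorem multiPow_add {n : ℕ} {A : Fin n → Module.End ℂ (Smooth n)}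
    (hA : ∀ i j, Commute (A i) (A j)) (k h : Fin n → ℕ) :
    multiPow A (k + h) = multiPow A k * multiPow A h := by
  have key : ∀ l : List (Fin n), (l.map fun i => A i ^ (k + h) i).reverse.prod =
      (l.map fun i => A i ^ k i).reverse.prod * (l.map fun i => A i ^ h i).reverse.prod := by
    intro l
    induction l with
    | nil => simp
    | cons i l ih =>
      have hc : Commute (A i ^ k i) (l.map fun i => A i ^ h i).reverse.prod := by
        refine Commute.list_prod_right _ _ fun B hB => ?_
        obtain ⟨j, -, rfl⟩ := List.mem_map.1 (List.mem_reverse.1 hB)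
        exact (hA i j).pow_pow _ _
      simp only [List.map_cons, List.reverse_cons, List.prod_append, List.prod_singleton]
      rw [ih, Pi.add_apply, pow_add, mul_assoc, mul_assoc, ← mul_assoc (A i ^ k i), hc.eq,
        mul_assoc]
  exact key _

theorem multiPow_single {n : ℕ} (A : Fin n → Module.End ℂ (Smooth n)) (i : Fin n) :
    multiPow A (Pi.single i 1) = A i := by
  have h0 : ∀ l : List (Fin n), i ∉ l →
      (l.map fun j => A j ^ (Pi.single i 1 : Fin n → ℕ) j).reverse.prod = 1 := by
    intro l hl
    refine List.prod_eq_one fun B hB => ?_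
    obtain ⟨j, hj, rfl⟩ := List.mem_map.1 (List.mem_reverse.1 hB)
    rw [Pi.single_eq_of_ne (by rintro rfl; exact hl hj), pow_zero]
  have key : ∀ l : List (Fin n), l.Nodup → i ∈ l →
      (l.map fun j => A j ^ (Pi.single i 1 : Fin n → ℕ) j).reverse.prod = A i := by
    intro l hl hi
    obtain ⟨l₁, l₂, rfl⟩ := List.append_of_mem hi
    rw [List.nodup_middle, List.nodup_cons, List.mem_append, not_or] at hl
    simp [h0 l₁ hl.1.1, h0 l₂ hl.1.2, List.reverse_append, -List.map_reverse]
  exact key _ (List.nodup_finRange n) (List.mem_finRange i)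

theorem multiPow_opT_mul_opT {n : ℕ} (k : Fin n → ℕ) (i : Fin n) :
    multiPow opT k * opT i = multiPow opT (k + Pi.single i 1) := by
  rw [multiPow_add commute_opT, multiPow_single]

theorem exists_eq_multiPow_opT {n : ℕ} {A : Module.End ℂ (Smooth n)}
    (hA : A ∈ Submonoid.closure (Set.range (opT (n := n)))) : ∃ k, A = multiPow opT k := by
  induction hA using Submonoid.closure_induction_right with
  | one => exact ⟨0, (multiPow_zero _).symm⟩
  | mul_right B _ C hC ih =>
    obtain ⟨k, rfl⟩ := ih
    obtain ⟨i, rfl⟩ := hC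
    exact ⟨_, multiPow_opT_mul_opT k i⟩

theorem multiPow_opT_mem_closure {n : ℕ} (k : Fin n → ℕ) :
    multiPow opT k ∈ Submonoid.closure (Set.range (opT (n := n))) := by
  refine Submonoid.list_prod_mem _ fun B hB => ?_
  obtain ⟨j, -, rfl⟩ := List.mem_map.1 (List.mem_reverse.1 hB)
  exact pow_mem (Submonoid.subset_closure (Set.mem_range_self j)) _

theorem lambdaMap_eq {n : ℕ} (μ : Fin n → ℝ) (k : Fin n → ℕ) :
    lambdaMap μ k = multiPow (opB μ) k * LinearMap.mulLeft ℂ (powMu μ) := by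
  have key : ∀ l : List (Fin n), SemiconjBy (LinearMap.mulLeft ℂ (powMu μ))
      (l.map fun i => opS μ i ^ k i).reverse.prod (l.map fun i => opB μ i ^ k i).reverse.prod := by
    intro l
    induction l with
    | nil => simp
    | cons i l ih =>
      simp only [List.map_cons, List.reverse_cons, List.prod_append, List.prod_singleton]
      exact ih.mul_right ((semiconjBy_powMu μ i).pow_right _)
  exact (key _).eq

/-! ### Weighted suprema in `[0, ∞]` -/

/-- The supremum `sup_x (1 + ‖x‖²)^m |f(x)|` in `[0, ∞]`. -/
def wSup {n : ℕ} (m : ℕ) (f : Smooth n) : ENNReal := ⨆ x, ENNReal.ofReal (weighted m f x)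

theorem wSup_le_ofReal {n : ℕ} {m : ℕ} {f : Smooth n} {V : ℝ} (h : ∀ x, weighted m f x ≤ V) :
    wSup m f ≤ ENNReal.ofReal V :=
  iSup_le fun x => ENNReal.ofReal_le_ofReal (h x)

theorem weighted_le_toReal_wSup {n : ℕ} {m : ℕ} {f : Smooth n} (h : wSup m f ≠ ⊤)
    (x : orthant n) : weighted m f x ≤ (wSup m f).toReal :=
  (ENNReal.ofReal_le_iff_le_toReal h).1 (le_iSup (fun x => ENNReal.ofReal (weighted m f x)) x)

theorem wSup_ne_top_iff {n : ℕ} {m : ℕ} {f : Smooth n} : wSup m f ≠ ⊤ ↔ WeightedBdd m f := by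
  refine ⟨fun h => ⟨_, Set.forall_mem_range.2 (weighted_le_toReal_wSup h)⟩, ?_⟩
  rintro ⟨V, hV⟩
  exact ne_top_of_le_ne_top ENNReal.ofReal_ne_top (wSup_le_ofReal fun x => hV ⟨x, rfl⟩)

theorem iSup_weighted {n : ℕ} (m : ℕ) (f : Smooth n) :
    ⨆ x, weighted m f x = (wSup m f).toReal := by
  rw [wSup, ENNReal.toReal_iSup fun x => ENNReal.ofReal_ne_top]
  simp only [ENNReal.toReal_ofReal (weighted_nonneg m f _)]

theorem wSup_add_le {n : ℕ} (m : ℕ) (f g : Smooth n) :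
    wSup m (f + g) ≤ wSup m f + wSup m g := by
  refine iSup_le fun x => (ENNReal.ofReal_le_ofReal (weighted_add_le m f g x)).trans ?_
  rw [ENNReal.ofReal_add (weighted_nonneg _ _ _) (weighted_nonneg _ _ _)]
  exact add_le_add (le_iSup (fun x => ENNReal.ofReal (weighted m f x)) x)
    (le_iSup (fun x => ENNReal.ofReal (weighted m g x)) x)

theorem wSup_smul_le {n : ℕ} (m : ℕ) (c : ℂ) (f : Smooth n) :
    wSup m (c • f) ≤ ‖c‖₊ * wSup m f := by
  refine iSup_le fun x => ?_
  rw [weighted_smul, ENNReal.ofReal_mul (norm_nonneg c), ofReal_norm, enorm_eq_nnnorm]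
  gcongr
  exact le_iSup (fun x => ENNReal.ofReal (weighted m f x)) x

/-- Because `xᵢ² ≤ 1 + ‖x‖²`. -/
theorem wSup_coordPow_two_mul_le {n : ℕ} (m : ℕ) (i : Fin n) (f : Smooth n) :
    wSup m (coordPow i 2 * f) ≤ wSup (m + 1) f := by
  refine iSup_mono fun x => ENNReal.ofReal_le_ofReal ?_
  have h : x.1 i ^ 2 ≤ 1 + ∑ j, x.1 j ^ 2 := by
    have := Finset.single_le_sum (f := fun j => x.1 j ^ 2) (fun j _ => sq_nonneg _)
      (Finset.mem_univ i)
    exact this.trans (le_add_of_nonneg_left zero_le_one)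
  have hx : ‖(coordPow i 2).1 x‖ = x.1 i ^ 2 := by
    rw [coordPow_apply, Complex.norm_real, Real.rpow_ofNat, Real.norm_of_nonneg (sq_nonneg _)]
  change (1 + ∑ i, x.1 i ^ 2) ^ m * ‖(coordPow i 2).1 x * f.1 x‖ ≤
    (1 + ∑ i, x.1 i ^ 2) ^ (m + 1) * ‖f.1 x‖
  rw [norm_mul, hx, pow_succ (1 + ∑ i, x.1 i ^ 2), mul_assoc]
  exact mul_le_mul_of_nonneg_left (mul_le_mul_of_nonneg_right h (norm_nonneg _)) (by positivity)

/-! ### Domination by the seminorms `sup_x (1 + ‖x‖²)^m |T^k f(x)|` -/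

/-- The functional `P` is bounded by a multiple of a finite sum of functionals
`f ↦ sup_x (1 + ‖x‖²)^m |T^k f(x)|`. -/
def Dominated {n : ℕ} (P : Smooth n → ENNReal) : Prop :=
  ∃ (C : NNReal) (s : Finset (ℕ × (Fin n → ℕ))),
    ∀ f, P f ≤ C * ∑ q ∈ s, wSup q.1 (multiPow opT q.2 f)

theorem Dominated.mono {n : ℕ} {P Q : Smooth n → ENNReal} (hQ : Dominated Q)
    (h : ∀ f, P f ≤ Q f) : Dominated P := by
  obtain ⟨C, s, hs⟩ := hQ
  exact ⟨C, s, fun f => (h f).trans (hs f)⟩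

theorem dominated_wSup {n : ℕ} (m : ℕ) (k : Fin n → ℕ) :
    Dominated fun f => wSup m (multiPow opT k f) :=
  ⟨1, {(m, k)}, fun f => by simp⟩

theorem dominated_zero {n : ℕ} : Dominated fun _ : Smooth n => 0 := ⟨0, ∅, fun f => by simp⟩

theorem Dominated.add {n : ℕ} {P Q : Smooth n → ENNReal} (hP : Dominated P)
    (hQ : Dominated Q) : Dominated fun f => P f + Q f := by
  classical
  obtain ⟨C, s, hs⟩ := hP
  obtain ⟨D, t, ht⟩ := hQ
  refine ⟨C + D, s ∪ t, fun f => ?_⟩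
  rw [ENNReal.coe_add, add_mul]
  refine add_le_add ((hs f).trans ?_) ((ht f).trans ?_)
  · exact mul_le_mul_right (Finset.sum_le_sum_of_subset Finset.subset_union_left) _
  · exact mul_le_mul_right (Finset.sum_le_sum_of_subset Finset.subset_union_right) _

theorem Dominated.const_mul {n : ℕ} {P : Smooth n → ENNReal} (hP : Dominated P) (D : NNReal) :
    Dominated fun f => D * P f := by
  obtain ⟨C, s, hs⟩ := hP
  refine ⟨D * C, s, fun f => ?_⟩
  rw [ENNReal.coe_mul, mul_assoc]
  exact mul_le_mul_right (hs f) _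

theorem Dominated.sum {n : ℕ} {ι : Type*} {P : ι → Smooth n → ENNReal} {s : Finset ι}
    (hP : ∀ q ∈ s, Dominated (P q)) : Dominated fun f => ∑ q ∈ s, P q f := by
  classical
  induction s using Finset.induction_on with
  | empty => simpa using dominated_zero
  | insert q s hq ih =>
    simp only [Finset.sum_insert hq]
    exact (hP q (Finset.mem_insert_self q s)).add
      (ih fun r hr => hP r (Finset.mem_insert_of_mem hr))

/-- The operator `L` is bounded for the functionals `f ↦ sup_x (1 + ‖x‖²)^m |T^k f(x)|`. -/
def IsBoundedOp {n : ℕ} (L : Module.End ℂ (Smooth n)) : Prop :=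
  ∀ m k, Dominated fun f => wSup m (multiPow opT k (L f))

theorem Dominated.comp {n : ℕ} {P : Smooth n → ENNReal} (hP : Dominated P)
    {L : Module.End ℂ (Smooth n)} (hL : IsBoundedOp L) : Dominated fun f => P (L f) := by
  obtain ⟨C, s, hs⟩ := hP
  exact ((Dominated.sum fun (q : ℕ × (Fin n → ℕ)) (_ : q ∈ s) => hL q.1 q.2).const_mul C).mono
    fun f => hs (L f)

namespace IsBoundedOp

theorem one {n : ℕ} : IsBoundedOp (1 : Module.End ℂ (Smooth n)) := dominated_wSup

theorem mul {n : ℕ} {L L' : Module.End ℂ (Smooth n)} (hL : IsBoundedOp L)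
    (hL' : IsBoundedOp L') : IsBoundedOp (L * L') :=
  fun m k => (hL m k).comp hL'

theorem add {n : ℕ} {L L' : Module.End ℂ (Smooth n)} (hL : IsBoundedOp L)
    (hL' : IsBoundedOp L') : IsBoundedOp (L + L') :=
  fun m k => ((hL m k).add (hL' m k)).mono fun f => by
    rw [LinearMap.add_apply, map_add]
    exact wSup_add_le _ _ _

theorem smul {n : ℕ} {L : Module.End ℂ (Smooth n)} (hL : IsBoundedOp L) (c : ℂ) :
    IsBoundedOp (c • L) :=
  fun m k => ((hL m k).const_mul ‖c‖₊).mono fun f => by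
    rw [LinearMap.smul_apply, map_smul]
    exact wSup_smul_le _ _ _

theorem pow {n : ℕ} {L : Module.End ℂ (Smooth n)} (hL : IsBoundedOp L) (j : ℕ) :
    IsBoundedOp (L ^ j) := by
  induction j with
  | zero => exact one
  | succ j ih => exact (pow_succ L j) ▸ ih.mul hL

theorem list_prod {n : ℕ} {l : List (Module.End ℂ (Smooth n))} (hl : ∀ L ∈ l, IsBoundedOp L) :
    IsBoundedOp l.prod := by
  induction l with
  | nil => exact one
  | cons L l ih =>
    rw [List.prod_cons]
    exact (hl L List.mem_cons_self).mul (ih fun B hB => hl B (List.mem_cons_of_mem _ hB))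

theorem prod_map_pow {n : ℕ} {A : Fin n → Module.End ℂ (Smooth n)} (hA : ∀ i, IsBoundedOp (A i))
    (k : Fin n → ℕ) (l : List (Fin n)) :
    IsBoundedOp (l.map fun i => A i ^ k i).reverse.prod := by
  refine list_prod fun B hB => ?_
  obtain ⟨j, -, rfl⟩ := List.mem_map.1 (List.mem_reverse.1 hB)
  exact (hA j).pow _

end IsBoundedOp

theorem isBoundedOp_opT {n : ℕ} (i : Fin n) : IsBoundedOp (opT i) := by
  intro m k
  have h : ∀ f, multiPow opT k (opT i f) = multiPow opT (k + Pi.single i 1) f := fun f => by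
    rw [← multiPow_opT_mul_opT]
    rfl
  simp only [h]
  exact dominated_wSup _ _

theorem isBoundedOp_mulLeft_coordPow_two {n : ℕ} (i : Fin n) :
    IsBoundedOp (LinearMap.mulLeft ℂ (coordPow i 2)) := by
  intro m k
  have hk := multiPow_opT_mem_closure k
  generalize multiPow opT k = A at hk ⊢
  induction hk using Submonoid.closure_induction_right with
  | one =>
    have h := dominated_wSup (n := n) (m + 1) 0
    rw [multiPow_zero] at h
    exact h.mono fun f => wSup_coordPow_two_mul_le m i f
  | mul_right A hA B hB ih =>
    obtain ⟨j, rfl⟩ := hB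
    rcases eq_or_ne j i with rfl | hj
    -- The commutator term `2A` must again be a power `T^h` to be dominated, hence the induction
    -- over the monoid generated by the `Tᵢ`.
    · obtain ⟨h, rfl⟩ := exists_eq_multiPow_opT hA
      refine ((ih.comp (isBoundedOp_opT j)).add ((dominated_wSup m h).const_mul ‖(2 : ℂ)‖₊)).mono
        fun f => ?_
      have e : (multiPow opT h * opT j) (LinearMap.mulLeft ℂ (coordPow j 2) f) =
          multiPow opT h (LinearMap.mulLeft ℂ (coordPow j 2) (opT j f)) +
            (2 : ℂ) • multiPow opT h f := by
        have := LinearMap.congr_fun (opT_mulLeft_coordPow_two j) f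
        change opT j (LinearMap.mulLeft ℂ (coordPow j 2) f) =
          LinearMap.mulLeft ℂ (coordPow j 2) (opT j f) + (2 : ℂ) • f at this
        rw [Module.End.mul_apply, this, map_add, map_smul]
      rw [e]
      exact (wSup_add_le _ _ _).trans (add_le_add_right (wSup_smul_le _ _ _) _)
    · refine (ih.comp (isBoundedOp_opT j)).mono fun f => ?_
      have := LinearMap.congr_fun (commute_opT_mulLeft_coordPow hj 2).eq f
      simp only [Module.End.mul_apply] at this ⊢
      rw [this]

theorem isBoundedOp_opB {n : ℕ} (μ : Fin n → ℝ) (i : Fin n) : IsBoundedOp (opB μ i) :=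
  (((isBoundedOp_mulLeft_coordPow_two i).mul (isBoundedOp_opT i)).add
    (IsBoundedOp.one.smul _)).mul (isBoundedOp_opT i)

theorem dominated_wSup_multiPow_opB {n : ℕ} (μ : Fin n → ℝ) (m : ℕ) (k : Fin n → ℕ) :
    Dominated fun f => wSup m (multiPow (opB μ) k f) := by
  have h := IsBoundedOp.prod_map_pow (isBoundedOp_opB μ) k (List.finRange n) m 0
  rw [multiPow_zero] at h
  exact h

/-! ### The converse estimate -/

/-- The functions `f` such that `sup_x (1 + ‖x‖²)^m |T^k f(x)| < ∞` for all `m` and `k`. -/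
def IsRapid {n : ℕ} (f : Smooth n) : Prop := ∀ m k, WeightedBdd m (multiPow opT k f)

theorem IsRapid.weightedBdd {n : ℕ} {f : Smooth n} (hf : IsRapid f) (m : ℕ) :
    WeightedBdd m f := by
  have h := hf m 0
  rwa [multiPow_zero] at h

theorem Dominated.ne_top {n : ℕ} {P : Smooth n → ENNReal} (hP : Dominated P) {f : Smooth n}
    (hf : IsRapid f) : P f ≠ ⊤ := by
  obtain ⟨C, s, hs⟩ := hP
  refine ne_top_of_le_ne_top (ENNReal.mul_ne_top ENNReal.coe_ne_top ?_) (hs f)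
  exact ENNReal.sum_ne_top.2 fun q _ => wSup_ne_top_iff.2 (hf q.1 q.2)

theorem IsBoundedOp.isRapid {n : ℕ} {L : Module.End ℂ (Smooth n)} (hL : IsBoundedOp L)
    {f : Smooth n} (hf : IsRapid f) : IsRapid (L f) :=
  fun m k => wSup_ne_top_iff.1 ((hL m k).ne_top hf)

theorem exists_wSup_le_wSup_opD {n : ℕ} (i : Fin n) {c : ℝ} (hc : 0 < c) (m : ℕ) :
    ∃ (C : NNReal) (M : ℕ), ∀ f : Smooth n, (∀ N, WeightedBdd N f) →
      wSup m f ≤ C * wSup M (opD c i f) := by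
  -- `M = m + N` secures both `m ≤ M` and `c < 2M`.
  obtain ⟨N, hN⟩ := exists_nat_gt c
  have hM : c < 2 * ((m + N : ℕ) : ℝ) := by push_cast; nlinarith [m.cast_nonneg (α := ℝ)]
  set M := m + N
  have hC : 0 < 2 ^ m * (2 / c + 1 / (2 * (M : ℝ) - c)) := by
    have : 0 < 2 * (M : ℝ) - c := by linarith
    positivity
  refine ⟨Real.toNNReal (2 ^ m * (2 / c + 1 / (2 * (M : ℝ) - c))), M, fun f hf => ?_⟩
  -- If the right side is infinite, positivity of the constant is needed, since `0 * ⊤ = 0`.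
  by_cases h : wSup M (opD c i f) = ⊤
  · rw [h, ENNReal.mul_top]
    · exact le_top
    · simpa using hC
  · refine (wSup_le_ofReal (weighted_le_of_weighted_opD_le i hc (Nat.le_add_right m N) hM hf
      (weighted_le_toReal_wSup h))).trans ?_
    rw [ENNReal.ofReal_mul hC.le, ENNReal.ofReal_toReal h]
    rfl

/-- Inverting `D_c` bounds `Tᵢ^{j+1} f` by `D_c Tᵢ^{j+1} f = Tᵢ^j (Bᵢ f)`, and the induction
hypothesis applies to `Bᵢ f`, which is again rapid. -/
theorem exists_wSup_opT_pow_le {n : ℕ} {μ : Fin n → ℝ} (hμ : ∀ i, -1 / 2 ≤ μ i) (i : Fin n)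
    (j m : ℕ) : ∃ (C : NNReal) (M : ℕ), ∀ f : Smooth n, IsRapid f →
      wSup m ((opT i ^ j) f) ≤ C * wSup M ((opB μ i ^ j) f) := by
  induction j generalizing m with
  | zero => exact ⟨1, m, fun f _ => by simp⟩
  | succ j ih =>
    -- This is where the lower bound on `μ` enters.
    have hc : 0 < 2 * μ i + 2 + 2 * (j : ℝ) := by
      have := hμ i
      have := j.cast_nonneg (α := ℝ)
      linarith
    obtain ⟨C, M, hCM⟩ := exists_wSup_le_wSup_opD i hc m
    obtain ⟨C', M', hCM'⟩ := ih M
    refine ⟨C * C', M', fun f hf => ?_⟩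
    refine (hCM _ (((isBoundedOp_opT i).pow (j + 1)).isRapid hf).weightedBdd).trans ?_
    rw [ENNReal.coe_mul, mul_assoc]
    have h := hCM' _ ((isBoundedOp_opB μ i).isRapid hf)
    rw [← Module.End.mul_apply, ← Module.End.mul_apply, opT_pow_mul_opB, ← pow_succ] at h
    exact mul_le_mul_right h _

/-- One coordinate is converted at a time. Operators in different coordinates commute, so the
`B`-factors already obtained can be moved past `Tᵢ^{kᵢ}`; `Tᵢ` and `Bᵢ` need not commute, whence the
list without repetitions. -/
theorem exists_wSup_multiPow_opT_le {n : ℕ} {μ : Fin n → ℝ} (hμ : ∀ i, -1 / 2 ≤ μ i)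
    (m : ℕ) (k : Fin n → ℕ) : ∃ (C : NNReal) (M : ℕ), ∀ f : Smooth n, IsRapid f →
      wSup m (multiPow opT k f) ≤ C * wSup M (multiPow (opB μ) k f) := by
  have key : ∀ l : List (Fin n), l.Nodup → ∃ (C : NNReal) (M : ℕ), ∀ f : Smooth n, IsRapid f →
      wSup m ((l.map fun i => opT i ^ k i).reverse.prod f) ≤
        C * wSup M ((l.map fun i => opB μ i ^ k i).reverse.prod f) := by
    intro l hl
    induction l with
    | nil => exact ⟨1, m, fun f _ => by simp⟩
    | cons i l ih =>
      rw [List.nodup_cons] at hl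
      obtain ⟨C, M, hCM⟩ := ih hl.2
      obtain ⟨C', M', hCM'⟩ := exists_wSup_opT_pow_le hμ i (k i) M
      refine ⟨C * C', M', fun f hf => ?_⟩
      have hcomm : ∀ A : Module.End ℂ (Smooth n), (∀ j, j ≠ i → Commute A (opB μ j)) →
          Commute (A ^ k i) (l.map fun i => opB μ i ^ k i).reverse.prod := by
        intro A hA
        refine Commute.list_prod_right _ _ fun B hB => ?_
        obtain ⟨j, hj, rfl⟩ := List.mem_map.1 (List.mem_reverse.1 hB)
        exact (hA j (by rintro rfl; exact hl.1 hj)).pow_pow _ _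
      have h := hCM' _ ((IsBoundedOp.prod_map_pow (isBoundedOp_opB μ) k l).isRapid hf)
      rw [← Module.End.mul_apply, ← Module.End.mul_apply,
        (hcomm _ fun j hj => commute_opT_opB μ hj.symm).eq,
        (hcomm _ fun j hj => commute_opB μ hj.symm).eq] at h
      simp only [List.map_cons, List.reverse_cons, List.prod_append, List.prod_singleton]
      refine (hCM _ (((isBoundedOp_opT i).pow (k i)).isRapid hf)).trans ?_
      rw [ENNReal.coe_mul, mul_assoc]
      exact mul_le_mul_right h _
  exact key _ (List.nodup_finRange n)

/-! ### The two families of seminorms -/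

theorem isRapid_powMu_mul {n : ℕ} {μ : Fin n → ℝ} (φ : HSpace μ) : IsRapid (powMu μ * φ.1) :=
  φ.2

theorem gammaFamily_apply {n : ℕ} (μ : Fin n → ℝ) (q : ℕ × (Fin n → ℕ)) (φ : HSpace μ) :
    gammaFamily μ q φ = (wSup q.1 (multiPow opT q.2 (powMu μ * φ.1))).toReal :=
  iSup_weighted _ _

theorem lambdaMap_apply {n : ℕ} (μ : Fin n → ℝ) (k : Fin n → ℕ) (φ : Smooth n) :
    lambdaMap μ k φ = multiPow (opB μ) k (powMu μ * φ) := by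
  rw [lambdaMap_eq]
  rfl

theorem lambdaFamily_apply {n : ℕ} (μ : Fin n → ℝ) (h : LambdaFinite μ)
    (q : ℕ × (Fin n → ℕ)) (φ : HSpace μ) :
    lambdaFamily μ h q φ = (wSup q.1 (multiPow (opB μ) q.2 (powMu μ * φ.1))).toReal := by
  rw [← lambdaMap_apply]
  exact iSup_weighted _ _

theorem lambdaFinite {n : ℕ} (μ : Fin n → ℝ) : LambdaFinite μ := by
  intro m k φ
  rw [lambdaMap_apply]
  exact wSup_ne_top_iff.1 ((dominated_wSup_multiPow_opB μ m k).ne_top (isRapid_powMu_mul φ))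

theorem isBounded_gammaFamily_lambdaFamily {n : ℕ} (μ : Fin n → ℝ) :
    Seminorm.IsBounded (gammaFamily μ) (lambdaFamily μ (lambdaFinite μ)) LinearMap.id := by
  intro q
  obtain ⟨C, s, hs⟩ := dominated_wSup_multiPow_opB μ q.1 q.2
  -- A sum over `s` is at most `s.card` times the supremum of the seminorms.
  refine ⟨s, C * s.card, fun φ => ?_⟩
  have hfin : ∀ q ∈ s, wSup q.1 (multiPow opT q.2 (powMu μ * φ.1)) ≠ ⊤ :=
    fun q _ => wSup_ne_top_iff.2 (isRapid_powMu_mul φ q.1 q.2)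
  have h := ENNReal.toReal_mono
    (ENNReal.mul_ne_top ENNReal.coe_ne_top (ENNReal.sum_ne_top.2 hfin)) (hs (powMu μ * φ.1))
  rw [← lambdaFamily_apply μ (lambdaFinite μ), ENNReal.toReal_mul, ENNReal.toReal_sum hfin,
    ENNReal.coe_toReal] at h
  simp only [← gammaFamily_apply μ] at h
  have hsum : ∑ r ∈ s, gammaFamily μ r φ ≤ s.card * s.sup (gammaFamily μ) φ := by
    have := Finset.sum_le_card_nsmul s (fun r => gammaFamily μ r φ) (s.sup (gammaFamily μ) φ)
      fun r hr => Seminorm.le_finset_sup_apply hr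
    simpa using this
  refine h.trans ?_
  rw [smul_apply, NNReal.smul_def, NNReal.coe_mul, NNReal.coe_natCast, smul_eq_mul,
    mul_assoc]
  exact mul_le_mul_of_nonneg_left hsum C.2

theorem isBounded_lambdaFamily_gammaFamily {n : ℕ} {μ : Fin n → ℝ} (hμ : ∀ i, -1 / 2 ≤ μ i) :
    Seminorm.IsBounded (lambdaFamily μ (lambdaFinite μ)) (gammaFamily μ) LinearMap.id := by
  intro q
  obtain ⟨C, M, hCM⟩ := exists_wSup_multiPow_opT_le hμ q.1 q.2
  refine ⟨{(M, q.2)}, C, fun φ => ?_⟩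
  have h := ENNReal.toReal_mono (ENNReal.mul_ne_top ENNReal.coe_ne_top
    ((dominated_wSup_multiPow_opB μ M q.2).ne_top (isRapid_powMu_mul φ)))
    (hCM _ (isRapid_powMu_mul φ))
  rw [← gammaFamily_apply, ENNReal.toReal_mul, ENNReal.coe_toReal,
    ← lambdaFamily_apply μ (lambdaFinite μ) (M, q.2)] at h
  rw [Finset.sup_singleton]
  exact h

end Zemanian

end

theorem mainTheorem8 (n : ℕ) (μ : Fin n → ℝ) (hμ : ∀ i, -1 / 2 ≤ μ i) :
    ∃ hfin : Zemanian.LambdaFinite μ,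
      Zemanian.seminormTopology (Zemanian.lambdaFamily μ hfin) =
        Zemanian.seminormTopology (Zemanian.gammaFamily μ) := by
  refine ⟨Zemanian.lambdaFinite μ, ?_⟩
  let _ := Zemanian.seminormTopology (Zemanian.lambdaFamily μ (Zemanian.lambdaFinite μ))
  have h : WithSeminorms (Zemanian.lambdaFamily μ (Zemanian.lambdaFinite μ)) := ⟨rfl⟩
  exact (h.congr (Zemanian.isBounded_lambdaFamily_gammaFamily hμ)
    (Zemanian.isBounded_gammaFamily_lambdaFamily μ)).withSeminorms_eq
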